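/- Let $G$ be a finite group with identity $e$ and let $H\neq\{e\}$ be a subgroup of $G$. The generalized non-coprime graph $\Gamma_{G,H}$ is the simple undirected graph with vertex set $G\setminus\{e\}$ in which two distinct vertices $a,b$ are adjacent if and only if $\gcd(|a|,|b|)\neq 1$ and at least one of $a,b$ lies in $H$, where $|x|$ denotes the order of $x$. A graph is perfect if each of its induced subgraphs has equal clique number and chromatic number. Let $G$ be a cyclic group of order $p_1p_2p_3p_4$, where $p_1,p_2,p_3,p_4$ are distinct primes, and let $H\neq\{e\}$ be a subgroup of $G$. Then $\Gamma_{G,H}$ is perfect. Moreover, if $|H|$ is not a product of three primes, then for every $n>4$ neither the cycle $C_n$ nor its complement is an induced subgraph of $\Gamma_{G,H}$; and if $|H|$ is a product of three primes, then $\Gamma_{G,H}$ contains the cycle $C_6$ as an induced subgraph. -/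

import Mathlib

/-- The generalized non-coprime graph `Γ_{G,H}` of a group `G` with respect to a subgroup `H`:
the vertices are the non-identity elements of `G`, and two distinct vertices are adjacent iff
their orders are not coprime and at least one of them lies in `H`. -/
def genNonCoprimeGraph {G : Type*} [Group G] (H : Subgroup G) :
    SimpleGraph {x : G // x ≠ 1} where
  Adj a b := a ≠ b ∧ Nat.gcd (orderOf (a : G)) (orderOf (b : G)) ≠ 1 ∧
    ((a : G) ∈ H ∨ (b : G) ∈ H)
  symm := ⟨fun _ _ h => ⟨h.1.symm, Nat.gcd_comm _ _ ▸ h.2.1, h.2.2.symm⟩⟩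
  loopless := ⟨fun _ h => h.1 rfl⟩

/-- A (finite) graph is perfect if the clique number and the chromatic number of each of its
induced subgraphs are equal. -/
def IsPerfectGraph {V : Type*} (Γ : SimpleGraph V) : Prop :=
  ∀ s : Set V, (Γ.induce s).chromaticNumber = ((Γ.induce s).cliqueNum : ℕ∞)

/-! Label `x ∈ G` by the set of primes dividing `|x|` and let `T` be the set of primes dividing
`|H|`. Since `G` is cyclic of squarefree order, `x ∈ H` iff the label of `x` is contained in `T`, so
`Γ_{G,H}` joins two distinct elements iff their labels meet and one of the labels is contained in
`T`.

With at most four primes available, such a graph has a simplicial vertex, or a vertex whose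
non-neighbours all carry one label inside `T` (two disjoint pairs exhaust the four primes), or else
its labels inside `T` are all singletons. A simplicial vertex can be coloured last; in the other two
cases some independent set meets every maximal clique and can be given a colour of its own. By
induction the graph is coloured with as many colours as its clique number. Cycles of length at least
five and their complements have no simplicial vertex, and each of their vertices is an end of an
induced path on four vertices; this excludes the first two cases, and also the third one unless
`|T| = 3`.
-/

section Graph

open SimpleGraph

universe u

variable {V : Type u} {Γ : SimpleGraph V}

/-- `a` is an end of an induced path on four vertices of `Γ`. Non-adjacency is adjacency in `Γᶜ`,
which also makes the vertices distinct. -/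
def IsP4End (Γ : SimpleGraph V) (a : V) : Prop :=
  ∃ b c d, Γ.Adj a b ∧ Γ.Adj b c ∧ Γ.Adj c d ∧ Γᶜ.Adj a c ∧ Γᶜ.Adj a d ∧ Γᶜ.Adj b d

/-- No vertex is simplicial and every vertex is an end of an induced path on four vertices: the two
properties that the cycles of length at least five share with their complements. -/
def IsHoleLike (Γ : SimpleGraph V) : Prop :=
  ∀ v, ¬ Γ.IsClique (Γ.neighborSet v) ∧ IsP4End Γ v

/-- An independent set meeting every maximal clique. Maximality is avoided by asking that
each clique disjoint from the set be extendable by one of its vertices. -/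
structure IsIndepCliqueTransversal (Γ : SimpleGraph V) (I : Set V) : Prop where
  indep : Γ.IsIndepSet I
  extend : ∀ K : Set V, Γ.IsClique K → Disjoint K I → ∃ u ∈ I, ∀ w ∈ K, Γ.Adj u w

section Perfect

theorem colorable_of_induce_compl_singleton [Finite V] {v : V} {n : ℕ}
    (hv : (Γ.neighborSet v).ncard < n) (h : (Γ.induce {v}ᶜ).Colorable n) : Γ.Colorable n := by
  classical
  obtain ⟨C⟩ := h
  set c : V → ℕ := fun w => if hw : w = v then 0 else C ⟨w, hw⟩
  obtain ⟨m, hmn, hm⟩ : ∃ m ∈ Set.Iio n, m ∉ c '' Γ.neighborSet v :=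
    Set.exists_mem_notMem_of_ncard_lt_ncard
      ((Set.ncard_image_le (Set.toFinite _)).trans_lt (by simpa using hv))
  have hcol : ∀ w (hw : w ≠ v), c w = C ⟨w, hw⟩ := fun w hw => dif_neg hw
  have hfree : ∀ w, Γ.Adj v w → c w ≠ m := fun w hvw h => hm ⟨w, hvw, h⟩
  rw [colorable_iff_exists_bdd_nat_coloring]
  refine ⟨Coloring.mk (Function.update c v m) fun {a b} hab => ?_, fun w => ?_⟩
  · rcases eq_or_ne a v with rfl | ha
    · simpa [hab.ne'] using (hfree b hab).symm
    rcases eq_or_ne b v with rfl | hb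
    · simpa [ha] using hfree a hab.symm
    simpa [ha, hb, hcol, Fin.val_inj] using C.valid (v := ⟨a, ha⟩) (w := ⟨b, hb⟩) hab
  · change Function.update c v m w < n
    rcases eq_or_ne w v with rfl | hw
    · simpa using hmn
    · simp [hw, hcol]

theorem colorable_succ_of_induce_compl {I : Set V} {n : ℕ} (hI : Γ.IsIndepSet I)
    (h : (Γ.induce Iᶜ).Colorable n) : Γ.Colorable (n + 1) := by
  classical
  obtain ⟨C⟩ := h
  refine ⟨Coloring.mk (fun v => if hv : v ∈ I then Fin.last n else (C ⟨v, hv⟩).castSucc)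
    fun {a b} hab => ?_⟩
  by_cases ha : a ∈ I <;> by_cases hb : b ∈ I
  · exact absurd hab (hI ha hb hab.ne)
  · simpa [ha, hb] using (Fin.castSucc_lt_last _).ne'
  · simp [ha, hb, (Fin.castSucc_lt_last _).ne]
  · simpa [ha, hb] using C.valid (v := ⟨a, ha⟩) (w := ⟨b, hb⟩) hab

theorem ncard_neighborSet_lt_cliqueNum [Finite V] {v : V}
    (hv : Γ.IsClique (Γ.neighborSet v)) : (Γ.neighborSet v).ncard < Γ.cliqueNum := by
  classical
  have := Fintype.ofFinite V
  have hclique : Γ.IsClique (insert v (Γ.neighborSet v).toFinset : Finset V) := by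
    simpa using isClique_insert.2 ⟨hv, fun b hb _ => hb⟩
  have hcard := IsClique.card_le_cliqueNum (tc := hclique)
  rw [Finset.card_insert_of_notMem (by simp)] at hcard
  rwa [Set.ncard_eq_toFinset_card']

theorem IsIndepCliqueTransversal.cliqueNum_induce_compl_lt [Finite V] {I : Set V}
    (hI : IsIndepCliqueTransversal Γ I) : (Γ.induce Iᶜ).cliqueNum < Γ.cliqueNum := by
  classical
  obtain ⟨K, hK⟩ := (Γ.induce Iᶜ).exists_isNClique_cliqueNum
  rw [isNClique_induce_iff] at hK
  have hKI : Disjoint (K.map (.subtype _) : Set V) I := by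
    rw [Set.disjoint_left]
    simp +contextual
  obtain ⟨u, -, hKu⟩ := hI.extend _ hK.isClique hKI
  have hinsert := hK.insert hKu
  have := IsClique.card_le_cliqueNum (tc := hinsert.isClique)
  rwa [hinsert.card_eq] at this

theorem isPerfectGraph_of_hereditary (𝒞 : ∀ {W : Type u}, SimpleGraph W → Prop)
    (hered : ∀ {W : Type u} {Δ : SimpleGraph W} (s : Set W), 𝒞 Δ → 𝒞 (Δ.induce s))
    (reduce : ∀ {W : Type u} [Finite W] [Nonempty W] {Δ : SimpleGraph W}, 𝒞 Δ →
      (∃ v, Δ.IsClique (Δ.neighborSet v)) ∨ ∃ I, IsIndepCliqueTransversal Δ I)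
    [Finite V] (hΓ : 𝒞 Γ) : IsPerfectGraph Γ := by
  have colorable_cliqueNum : ∀ {W : Type u} [Finite W] {Δ : SimpleGraph W}, 𝒞 Δ →
      Δ.Colorable Δ.cliqueNum := by
    intro W _ Δ hΔ
    induction hn : Nat.card W using Nat.strong_induction_on generalizing W with
    | _ n ih =>
    subst hn
    have ih_compl : ∀ I : Set W, I.Nonempty →
        (Δ.induce Iᶜ).Colorable (Δ.induce Iᶜ).cliqueNum := fun I ⟨v, hv⟩ =>
      ih _ (Finite.card_subtype_lt (x := v) (by simpa using hv)) (hered _ hΔ) rfl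
    rcases isEmpty_or_nonempty W with _ | _
    · exact .of_isEmpty _
    rcases reduce hΔ with ⟨v, hv⟩ | ⟨I, hI⟩
    · exact colorable_of_induce_compl_singleton (ncard_neighborSet_lt_cliqueNum hv)
        ((ih_compl {v} (Set.singleton_nonempty v)).mono (cliqueNum_induce_le _))
    · obtain ⟨u, hu, -⟩ := hI.extend ∅ (by simp) (by simp)
      exact (colorable_succ_of_induce_compl hI.indep (ih_compl I ⟨u, hu⟩)).mono
        hI.cliqueNum_induce_compl_lt
  exact fun s => le_antisymm (colorable_cliqueNum (hered s hΓ)).chromaticNumber_le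
    cliqueNum_le_chromaticNumber

end Perfect

section Transversal

theorem exists_isIndepCliqueTransversal_of_not_isP4End {v : V}
    (hclique : Γ.IsClique (Γᶜ.neighborSet v)) (hv : ¬ IsP4End Γ v) :
    ∃ I, IsIndepCliqueTransversal Γ I := by
  have not_mem {u w : V} {K I : Set V} (hKI : Disjoint K I) (hu : u ∈ I) (hw : w ∈ K) : w ≠ u :=
    fun h => Set.disjoint_left.1 hKI hw (h ▸ hu)
  by_cases hu : ∃ u, Γᶜ.Adj v u
  · obtain ⟨u, hvu⟩ := hu
    refine ⟨{v, u}, ?_, fun K hK hKI => ?_⟩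
    · exact Set.pairwise_pair.2 fun _ => ⟨hvu.2, fun h => hvu.2 h.symm⟩
    · by_cases hall : ∀ w ∈ K, Γ.Adj v w
      · exact ⟨v, by simp, hall⟩
      push Not at hall
      obtain ⟨w, hwK, hvw⟩ := hall
      replace hvw : Γᶜ.Adj v w := ⟨(not_mem hKI (by simp) hwK).symm, hvw⟩
      have huw : Γ.Adj u w := hclique hvu hvw (not_mem hKI (by simp) hwK).symm
      refine ⟨u, by simp, fun x hx => ?_⟩
      rcases eq_or_ne x w with rfl | hxw
      · exact huw
      by_contra hux
      have hux' : Γᶜ.Adj x u := ⟨not_mem hKI (by simp) hx, fun h => hux h.symm⟩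
      by_cases hvx : Γ.Adj v x
      · exact hv ⟨x, w, u, hvx, hK hx hwK hxw, huw.symm, hvw, hvu, hux'⟩
      · exact hux (hclique hvu ⟨(not_mem hKI (by simp) hx).symm, hvx⟩ hux'.ne')
  · push Not at hu
    refine ⟨{v}, by simp, fun K _ hKI => ⟨v, rfl, fun w hw => ?_⟩⟩
    by_contra hvw
    exact hu w ⟨(not_mem hKI rfl hw).symm, hvw⟩

theorem isIndepCliqueTransversal_of_maximal [Nonempty V] {I : Set V}
    (hI : Maximal Γ.IsIndepSet I)
    (htrans : ∀ u ∈ I, ∀ x ∉ I, ∀ w ∉ I, Γ.Adj u x → Γ.Adj x w → Γ.Adj u w) :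
    IsIndepCliqueTransversal Γ I := by
  have dominated : ∀ x ∉ I, ∃ u ∈ I, Γ.Adj u x := fun x hx => by
    by_contra! h
    refine hx (hI.le_of_ge (y := insert x I) ?_ (Set.subset_insert x I) (Set.mem_insert x I))
    exact hI.prop.insert fun u hu _ => ⟨fun h' => h u hu h'.symm, h u hu⟩
  refine ⟨hI.prop, fun K hK hKI => ?_⟩
  have hKI' : ∀ w ∈ K, w ∉ I := fun w hw => Set.disjoint_left.1 hKI hw
  rcases K.eq_empty_or_nonempty with rfl | ⟨x, hx⟩
  · obtain ⟨v⟩ := ‹Nonempty V›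
    by_cases hv : v ∈ I
    · exact ⟨v, hv, by simp⟩
    · obtain ⟨u, hu, -⟩ := dominated v hv
      exact ⟨u, hu, by simp⟩
  · obtain ⟨u, hu, hux⟩ := dominated x (hKI' x hx)
    refine ⟨u, hu, fun w hw => ?_⟩
    rcases eq_or_ne x w with rfl | hxw
    · exact hux
    · exact htrans u hu x (hKI' x hx) w (hKI' w hw) hux (hK hx hw hxw)

end Transversal

section Cycle

variable {A : Type*} [AddCommGroup A] {g : A}

theorem circulantGraph_singleton_adj (hg : g ≠ 0) {u v : A} :
    (circulantGraph {g}).Adj u v ↔ u - v = g ∨ v - u = g := by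
  simp only [circulantGraph_adj, Set.mem_singleton_iff]
  grind

theorem isHoleLike_circulantGraph (h1 : g ≠ 0) (h2 : 2 • g ≠ 0) (h3 : 3 • g ≠ 0)
    (h4 : 4 • g ≠ 0) : IsHoleLike (circulantGraph {g}) := fun v => by
  refine ⟨fun h => ?_, v + g, v + 2 • g, v + 3 • g, ?_⟩
  · simp only [IsClique, Set.Pairwise, mem_neighborSet, circulantGraph_singleton_adj h1] at h
    have := @h (v + g) (by simp) (v - g) (by simp) (by grind)
    grind
  · simp only [compl_adj, circulantGraph_singleton_adj h1]
    refine ⟨?_, ?_, ?_, ?_, ?_, ?_⟩ <;> grind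

theorem isHoleLike_compl_circulantGraph (h1 : g ≠ 0) (h2 : 2 • g ≠ 0) (h3 : 3 • g ≠ 0)
    (h4 : 4 • g ≠ 0) : IsHoleLike (circulantGraph {g})ᶜ := fun v => by
  refine ⟨fun h => ?_, v + 2 • g, v - g, v + g, ?_⟩
  · simp only [IsClique, Set.Pairwise, mem_neighborSet, compl_adj,
      circulantGraph_singleton_adj h1] at h
    refine (@h (v + 2 • g) ?_ (v + 3 • g) ?_ ?_).2 ?_ <;> grind
  · simp only [compl_compl, compl_adj, circulantGraph_singleton_adj h1]
    refine ⟨?_, ?_, ?_, ?_, ?_, ?_⟩ <;> grind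

open Fin.CommRing in
theorem isHoleLike_cycleGraph {n : ℕ} (hn : 4 < n) :
    IsHoleLike (cycleGraph n) ∧ IsHoleLike (cycleGraph n)ᶜ := by
  obtain ⟨m, rfl⟩ := Nat.exists_eq_add_of_le' hn
  have smul_one_ne_zero (k : ℕ) (hk : 0 < k) (hk' : k < 5) : k • (1 : Fin (m + 5)) ≠ 0 := by
    rw [nsmul_one, Ne, Fin.natCast_eq_zero]
    exact Nat.not_dvd_of_pos_of_lt hk (by lia)
  have h1 : (1 : Fin (m + 5)) ≠ 0 := by simp
  have h2 := smul_one_ne_zero 2 (by simp) (by simp)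
  have h3 := smul_one_ne_zero 3 (by simp) (by simp)
  have h4 := smul_one_ne_zero 4 (by simp) (by simp)
  rw [cycleGraph_eq_circulantGraph]
  exact ⟨isHoleLike_circulantGraph h1 h2 h3 h4, isHoleLike_compl_circulantGraph h1 h2 h3 h4⟩

end Cycle

end Graph

section MeetGraph

open SimpleGraph

variable {V W α β : Type*} {f : V → Finset α} {T U : Finset α} {v w : V}

/-- Distinct vertices are adjacent iff their labels meet and one of the labels is contained in `T`.
Labelling an element of a cyclic group of squarefree order by the primes dividing its order, and
taking for `T` the primes dividing `|H|`, gives the graph `Γ_{G,H}`. -/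
def meetGraph (f : V → Finset α) (T : Finset α) : SimpleGraph V where
  Adj v w := v ≠ w ∧ ¬ Disjoint (f v) (f w) ∧ (f v ⊆ T ∨ f w ⊆ T)
  symm := ⟨fun _ _ h => ⟨h.1.symm, fun h' => h.2.1 h'.symm, h.2.2.symm⟩⟩
  loopless := ⟨fun _ h => h.1 rfl⟩

theorem meetGraph_adj :
    (meetGraph f T).Adj v w ↔ v ≠ w ∧ ¬ Disjoint (f v) (f w) ∧ (f v ⊆ T ∨ f w ⊆ T) :=
  Iff.rfl

theorem comap_meetGraph {φ : W → V} (hφ : Function.Injective φ) :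
    (meetGraph f T).comap φ = meetGraph (f ∘ φ) T := by
  ext a b
  simp [meetGraph_adj, hφ.eq_iff]

theorem meetGraph_map (e : α ↪ β) :
    meetGraph (fun v => (f v).map e) (T.map e) = meetGraph f T := by
  ext a b
  simp [meetGraph_adj]

section Adjacency

theorem meetGraph_adj_of_subset (hv : (f v).Nonempty) (hvT : f v ⊆ T) (hfvw : f v ⊆ f w)
    (hvw : v ≠ w) : (meetGraph f T).Adj v w :=
  ⟨hvw, fun h => hv.ne_empty (h.eq_bot_of_le hfvw), .inl hvT⟩

theorem meetGraph_adj_of_label_eq {x : V} (hxv : (meetGraph f T).Adj x v) (h : f v = f w)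
    (hwT : f w ⊆ T) (hxw : x ≠ w) : (meetGraph f T).Adj x w :=
  ⟨hxw, h ▸ hxv.2.1, .inr hwT⟩

theorem label_eq_of_meetGraph_adj (hv : (f v).card ≤ 1) (hw : (f w).card ≤ 1)
    (h : (meetGraph f T).Adj v w) : f v = f w := by
  obtain ⟨a, hav, haw⟩ := Finset.not_disjoint_iff.1 h.2.1
  rw [← Finset.eq_of_subset_of_card_le (Finset.singleton_subset_iff.2 hav) hv,
    ← Finset.eq_of_subset_of_card_le (Finset.singleton_subset_iff.2 haw) hw]

end Adjacency

section Trichotomy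

theorem isClique_compl_neighborSet_meetGraph {B : Finset α} (hf : ∀ v, (f v).Nonempty) (hB : B ⊆ T)
    (hv : ∀ w, (meetGraph f T)ᶜ.Adj v w → f w = B) :
    (meetGraph f T).IsClique ((meetGraph f T)ᶜ.neighborSet v) := fun a hva b hvb hab =>
  meetGraph_adj_of_subset (hf a) (hv a hva ▸ hB) (hv a hva ▸ hv b hvb ▸ subset_rfl) hab

theorem not_isP4End_meetGraph_of_nonadj_label {B : Finset α} (hB : B ⊆ T)
    (hv : ∀ w, (meetGraph f T)ᶜ.Adj v w → f w = B) : ¬ IsP4End (meetGraph f T) v := by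
  rintro ⟨b, c, d, -, hbc, -, hvc, hvd, hbd⟩
  exact hbd.2 (meetGraph_adj_of_label_eq hbc ((hv c hvc).trans (hv d hvd).symm)
    (hv d hvd ▸ hB) hbd.1)

variable [DecidableEq α]

theorem isClique_neighborSet_meetGraph (hv : (f v ∩ T).card ≤ 1)
    (hnb : ∀ w, (meetGraph f T).Adj v w → f w ⊆ T) :
    (meetGraph f T).IsClique ((meetGraph f T).neighborSet v) := by
  intro a hva b hvb hab
  obtain ⟨x, hxv, hxa⟩ := Finset.not_disjoint_iff.1 hva.2.1
  obtain ⟨y, hyv, hyb⟩ := Finset.not_disjoint_iff.1 hvb.2.1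
  have hxy : x = y := Finset.card_le_one.1 hv x (Finset.mem_inter.2 ⟨hxv, hnb a hva hxa⟩) y
    (Finset.mem_inter.2 ⟨hyv, hnb b hvb hyb⟩)
  exact ⟨hab, Finset.not_disjoint_iff.2 ⟨x, hxa, hxy ▸ hyb⟩, .inl (hnb a hva)⟩

theorem label_eq_sdiff_of_compl_meetGraph_adj (hf : ∀ v, (f v).Nonempty) (hfU : ∀ v, f v ⊆ U)
    (hTU : T ⊆ U) (hU : U.card ≤ 4) (hvT : f v ⊆ T) (hv : 1 < (f v).card)
    (hw : 1 < (f w ∩ T).card ∨ ∃ x, (meetGraph f T).Adj w x ∧ ¬ f x ⊆ T)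
    (hvw : (meetGraph f T)ᶜ.Adj v w) : f w = T \ f v := by
  have hdisj : Disjoint (f w) (f v) := by
    by_contra h
    exact hvw.2 ⟨hvw.1, fun h' => h h'.symm, .inl hvT⟩
  rcases hw with hw | ⟨x, hwx, hxT⟩
  · -- the labels of `v` and `w` are complementary pairs in `U`
    have hcard := Finset.card_sdiff_add_card_eq_card (hfU v)
    have hwU : f w ⊆ U \ f v := Finset.subset_sdiff.2 ⟨hfU w, hdisj⟩
    have hwT : f w ∩ T = U \ f v :=
      Finset.eq_of_subset_of_card_le (Finset.inter_subset_left.trans hwU) (by lia)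
    refine subset_antisymm (Finset.subset_sdiff.2 ⟨?_, hdisj⟩) ?_
    · exact hwU.trans (hwT ▸ Finset.inter_subset_right)
    · exact (Finset.sdiff_subset_sdiff hTU subset_rfl).trans (hwT ▸ Finset.inter_subset_left)
  · have hwT : f w ⊆ T := hwx.2.2.resolve_right hxT
    have hTU' : T.card < U.card := Finset.card_lt_card ⟨hTU, fun h => hxT ((hfU x).trans h)⟩
    have hcard := Finset.card_sdiff_add_card_eq_card hvT
    have := (hf w).card_pos
    exact Finset.eq_of_subset_of_card_le (Finset.subset_sdiff.2 ⟨hwT, hdisj⟩) (by lia)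

theorem meetGraph_trichotomy (hf : ∀ v, (f v).Nonempty) (hfU : ∀ v, f v ⊆ U) (hTU : T ⊆ U)
    (hU : U.card ≤ 4) :
    (∃ v, (meetGraph f T).IsClique ((meetGraph f T).neighborSet v)) ∨
    (∃ v, (meetGraph f T).IsClique ((meetGraph f T)ᶜ.neighborSet v) ∧
      ¬ IsP4End (meetGraph f T) v) ∨
    ∀ v, (f v ⊆ T → (f v).card ≤ 1) ∧ (¬ f v ⊆ T → 1 < (f v ∩ T).card) := by
  by_cases hA : ∃ v, (f v ∩ T).card ≤ 1 ∧ ∀ w, (meetGraph f T).Adj v w → f w ⊆ T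
  · obtain ⟨v, hv, hnb⟩ := hA
    exact .inl ⟨v, isClique_neighborSet_meetGraph hv hnb⟩
  have houtside : ∀ w, 1 < (f w ∩ T).card ∨ ∃ x, (meetGraph f T).Adj w x ∧ ¬ f x ⊆ T := by
    push Not at hA
    exact fun w => or_iff_not_imp_left.2 fun hw => hA w (not_lt.1 hw)
  by_cases hB : ∃ v, f v ⊆ T ∧ 1 < (f v).card
  · obtain ⟨v, hvT, hv⟩ := hB
    have hlabel : ∀ w, (meetGraph f T)ᶜ.Adj v w → f w = T \ f v := fun w =>
      label_eq_sdiff_of_compl_meetGraph_adj hf hfU hTU hU hvT hv (houtside w)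
    exact .inr (.inl ⟨v, isClique_compl_neighborSet_meetGraph hf Finset.sdiff_subset hlabel,
      not_isP4End_meetGraph_of_nonadj_label Finset.sdiff_subset hlabel⟩)
  · push Not at hB
    exact .inr (.inr fun v => ⟨hB v, fun hvT => (houtside v).resolve_right
      fun ⟨_, hvx, hxT⟩ => hvx.2.2.elim hvT hxT⟩)

end Trichotomy

section Perfect

theorem exists_isIndepCliqueTransversal_meetGraph [Finite V] [Nonempty V]
    (hin : ∀ v, f v ⊆ T → (f v).card ≤ 1) : ∃ I, IsIndepCliqueTransversal (meetGraph f T) I := by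
  have houtside : (meetGraph f T).IsIndepSet {v | ¬ f v ⊆ T} :=
    fun a ha b hb _ hab => hab.2.2.elim ha hb
  obtain ⟨I, hsub, hI⟩ := Finite.exists_le_maximal houtside
  have hcompl : ∀ x ∉ I, f x ⊆ T := fun x hx => by_contra fun h => hx (hsub h)
  refine ⟨I, isIndepCliqueTransversal_of_maximal hI fun u hu x hx w hw hux hxw => ?_⟩
  exact meetGraph_adj_of_label_eq hux
    (label_eq_of_meetGraph_adj (hin x (hcompl x hx)) (hin w (hcompl w hw)) hxw) (hcompl w hw)
    (ne_of_mem_of_not_mem hu hw)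

theorem isPerfectGraph_meetGraph [Finite V] (hf : ∀ v, (f v).Nonempty) (hfU : ∀ v, f v ⊆ U)
    (hTU : T ⊆ U) (hU : U.card ≤ 4) : IsPerfectGraph (meetGraph f T) := by
  classical
  refine isPerfectGraph_of_hereditary
    (fun {W} Δ => ∃ l : W → Finset α, (∀ v, (l v).Nonempty) ∧ (∀ v, l v ⊆ U) ∧ Δ = meetGraph l T)
    ?_ ?_ ⟨f, hf, hfU, rfl⟩
  · rintro W _ s ⟨l, hl, hlU, rfl⟩
    exact ⟨_, fun v => hl v, fun v => hlU v, comap_meetGraph Subtype.val_injective⟩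
  · rintro W _ _ _ ⟨l, hl, hlU, rfl⟩
    rcases meetGraph_trichotomy hl hlU hTU hU with hv | ⟨v, hclique, hv⟩ | hcards
    · exact .inl hv
    · exact .inr (exists_isIndepCliqueTransversal_of_not_isP4End hclique hv)
    · exact .inr (exists_isIndepCliqueTransversal_meetGraph fun v => (hcards v).1)

end Perfect

section Hole

theorem not_isP4End_meetGraph (hf : ∀ v, (f v).Nonempty) (hin : ∀ v, f v ⊆ T → (f v).card ≤ 1)
    (hout : ∀ v, ¬ f v ⊆ T → T ⊆ f v) (a : V) : ¬ IsP4End (meetGraph f T) a := by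
  rintro ⟨b, c, d, hab, hbc, hcd, hac, had, hbd⟩
  have same_label {x y : V} (hx : f x ⊆ T) (hy : f y ⊆ T) (h : (meetGraph f T).Adj x y) :
      f x = f y := label_eq_of_meetGraph_adj (hin x hx) (hin y hy) h
  by_cases hb : f b ⊆ T
  · have ha : ¬ f a ⊆ T := fun ha => hac.2
      (meetGraph_adj_of_label_eq hbc.symm (same_label ha hb hab).symm ha hac.1.symm).symm
    have hc : ¬ f c ⊆ T := fun hc => hac.2
      (meetGraph_adj_of_label_eq hab (same_label hb hc hbc) hc hac.1)
    have hd : f d ⊆ T := hcd.2.2.resolve_left hc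
    exact had.2 (meetGraph_adj_of_subset (hf d) hd (hd.trans (hout a ha)) had.1.symm).symm
  · have ha : f a ⊆ T := hab.2.2.resolve_right hb
    have hc : f c ⊆ T := hbc.2.2.resolve_left hb
    by_cases hd : f d ⊆ T
    · exact hbd.2 (meetGraph_adj_of_label_eq hbc (same_label hc hd hcd) hd hbd.1)
    · exact had.2 (meetGraph_adj_of_subset (hf a) ha (ha.trans (hout d hd)) had.1)

theorem not_isHoleLike_meetGraph [Nonempty V] (hf : ∀ v, (f v).Nonempty) (hfU : ∀ v, f v ⊆ U)
    (hTU : T ⊆ U) (hU : U.card ≤ 4) (hT : T.card ≠ 3) : ¬ IsHoleLike (meetGraph f T) := by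
  classical
  intro hole
  rcases meetGraph_trichotomy hf hfU hTU hU with ⟨v, hv⟩ | ⟨v, -, hv⟩ | hcards
  · exact (hole v).1 hv
  · exact hv (hole v).2
  · have hout : ∀ v, ¬ f v ⊆ T → T ⊆ f v := fun v hv => by
      have hTU' : T.card < U.card := Finset.card_lt_card ⟨hTU, fun h => hv ((hfU v).trans h)⟩
      have hcard := (hcards v).2 hv
      exact Finset.inter_eq_right.1
        (Finset.eq_of_subset_of_card_le Finset.inter_subset_right (by lia))
    obtain ⟨v⟩ := ‹Nonempty V›
    exact not_isP4End_meetGraph hf (fun v => (hcards v).1) hout v (hole v).2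

theorem not_isIndContained_meetGraph [Nonempty W] {Δ : SimpleGraph W} (hΔ : IsHoleLike Δ)
    (hf : ∀ v, (f v).Nonempty) (hfU : ∀ v, f v ⊆ U) (hTU : T ⊆ U) (hU : U.card ≤ 4)
    (hT : T.card ≠ 3) : ¬ Δ.IsIndContained (meetGraph f T) := by
  rintro ⟨φ⟩
  rw [← φ.comap_eq, comap_meetGraph φ.injective] at hΔ
  exact not_isHoleLike_meetGraph (fun w => hf (φ w)) (fun w => hfU (φ w)) hTU hU hT hΔ

end Hole

section Hexagon

/-- Labels realizing the 6-cycle as a meet graph with `T = {0, 1, 2}`: singletons inside `T`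
alternate with the labels `{i, i + 1, 3}` containing two consecutive ones. -/
def hexagonLabel : Fin 6 → Finset (Fin 4) :=
  ![{0}, {0, 1, 3}, {1}, {1, 2, 3}, {2}, {2, 0, 3}]

theorem meetGraph_hexagonLabel : meetGraph hexagonLabel {0, 1, 2} = cycleGraph 6 := by
  ext i j
  simp only [meetGraph_adj]
  revert i j
  decide

theorem cycleGraph_six_isIndContained_meetGraph (hf : ∀ A ⊆ U, A.Nonempty → ∃ v, f v = A)
    (hT : T.card = 3) (hTU : T ⊂ U) : (cycleGraph 6).IsIndContained (meetGraph f T) := by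
  classical
  obtain ⟨x, y, z, hxy, hxz, hyz, rfl⟩ := Finset.card_eq_three.1 hT
  obtain ⟨l, hlU, hlT⟩ := Finset.exists_of_ssubset hTU
  have hinj : Function.Injective ![x, y, z, l] := by
    obtain ⟨hlx, hly, hlz⟩ : l ≠ x ∧ l ≠ y ∧ l ≠ z := by simpa using hlT
    simp [Function.Injective, Fin.forall_fin_succ, hxy, hxy.symm, hxz, hxz.symm, hyz, hyz.symm,
      hlx, hlx.symm, hly, hly.symm, hlz, hlz.symm]
  set e : Fin 4 ↪ α := ⟨![x, y, z, l], hinj⟩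
  have hTe : ({0, 1, 2} : Finset (Fin 4)).map e = {x, y, z} := by simp [e]
  have heU : ∀ k, e k ∈ U := by
    simp_all [e, Fin.forall_fin_succ, Finset.ssubset_def, Finset.insert_subset_iff]
  have hlabel : ∀ i, ∃ v, f v = (hexagonLabel i).map e := fun i => by
    refine hf _ ?_ ?_
    · simpa [Finset.map_subset_iff_subset_preimage, Finset.subset_iff] using fun k _ => heU k
    · simpa using (by decide : ∀ i, (hexagonLabel i).Nonempty) i
  choose φ hφ using hlabel
  have hφ_inj : Function.Injective φ := fun i j hij => by
    have hij' : (hexagonLabel i).map e = (hexagonLabel j).map e := by rw [← hφ, ← hφ, hij]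
    exact (by decide : Function.Injective hexagonLabel) (Finset.map_injective e hij')
  refine isIndContained_iff_exists_comap_eq.2 ⟨⟨φ, hφ_inj⟩, ?_⟩
  rw [Function.Embedding.coeFn_mk, comap_meetGraph hφ_inj, ← hTe, ← meetGraph_hexagonLabel,
    ← meetGraph_map e]
  congr 1
  exact funext hφ

end Hexagon

end MeetGraph

section Arithmetic

open ArithmeticFunction

theorem dvd_iff_primeFactors_subset {d e : ℕ} (hd : Squarefree d) (he : e ≠ 0) :
    d ∣ e ↔ d.primeFactors ⊆ e.primeFactors := by
  rw [← Nat.prod_primeFactors_dvd_iff he, Nat.prod_primeFactors_of_squarefree hd]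

theorem card_primeFactors_eq_three_iff {n : ℕ} (hn : Squarefree n) : n.primeFactors.card = 3 ↔
    ∃ q₁ q₂ q₃ : ℕ, q₁.Prime ∧ q₂.Prime ∧ q₃.Prime ∧ n = q₁ * q₂ * q₃ := by
  constructor
  · intro h
    obtain ⟨q₁, q₂, q₃, h₁₂, h₁₃, h₂₃, hn3⟩ := Finset.card_eq_three.1 h
    have hprime : ∀ q ∈ ({q₁, q₂, q₃} : Finset ℕ), q.Prime := fun q hq =>
      Nat.prime_of_mem_primeFactors (hn3 ▸ hq)
    refine ⟨q₁, q₂, q₃, hprime _ (by simp), hprime _ (by simp), hprime _ (by simp), ?_⟩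
    rw [← Nat.prod_primeFactors_of_squarefree hn, hn3, Finset.prod_insert (by simp [h₁₂, h₁₃]),
      Finset.prod_pair h₂₃, mul_assoc]
  · rintro ⟨q₁, q₂, q₃, h₁, h₂, h₃, rfl⟩
    have card_eq :=
      (cardDistinctFactors_eq_cardFactors_iff_squarefree hn.ne_zero).2 hn
    rw [cardDistinctFactors_apply, ← List.card_toFinset] at card_eq
    rw [Nat.primeFactors, card_eq,
      cardFactors_mul (mul_ne_zero h₁.ne_zero h₂.ne_zero) h₃.ne_zero,
      cardFactors_mul h₁.ne_zero h₂.ne_zero,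
      cardFactors_apply_prime h₁, cardFactors_apply_prime h₂,
      cardFactors_apply_prime h₃]

variable {ι : Type*} [Fintype ι] {p : ι → ℕ}

theorem squarefree_prod_primes (hp : ∀ i, (p i).Prime) (hinj : Function.Injective p) :
    Squarefree (∏ i, p i) :=
  Finset.squarefree_prod_of_pairwise_isCoprime
    (fun i _ j _ hij => Nat.coprime_iff_isRelPrime.1
      ((Nat.coprime_primes (hp i) (hp j)).2 (hinj.ne hij)))
    fun i _ => (hp i).squarefree

theorem card_primeFactors_prod_primes (hp : ∀ i, (p i).Prime) (hinj : Function.Injective p) :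
    (∏ i, p i).primeFactors.card = Fintype.card ι := by
  have hprod : ∏ i, p i = ∏ q ∈ Finset.univ.map ⟨p, hinj⟩, q := by simp
  rw [hprod, Nat.primeFactors_prod (by simpa using hp), Finset.card_map, Finset.card_univ]

end Arithmetic

section CyclicGroup

variable {G : Type*} [Group G] [Finite G]

theorem primeFactors_orderOf_subset (x : G) :
    (orderOf x).primeFactors ⊆ (Nat.card G).primeFactors :=
  Nat.primeFactors_mono (orderOf_dvd_natCard x) Nat.card_pos.ne'

variable [IsCyclic G]

theorem mem_subgroup_iff_orderOf_dvd_card (H : Subgroup G) (x : G) :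
    x ∈ H ↔ orderOf x ∣ Nat.card H := by
  refine ⟨fun hx => H.orderOf_dvd_natCard hx, fun hx => ?_⟩
  let _ := IsCyclic.commGroup (α := G)
  have hle : H ≤ (powMonoidHom (Nat.card H) : G →* G).ker := fun y hy =>
    orderOf_dvd_iff_pow_eq_one.1 (H.orderOf_dvd_natCard hy)
  have hcard : Nat.card (powMonoidHom (Nat.card H) : G →* G).ker = Nat.card H := by
    rw [IsCyclic.card_powMonoidHom_ker, Nat.gcd_eq_right H.card_subgroup_dvd_card]
  rw [Subgroup.eq_of_le_of_card_ge hle hcard.le]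
  exact orderOf_dvd_iff_pow_eq_one.1 hx

theorem exists_orderOf_eq_of_dvd_card {d : ℕ} (hd : d ∣ Nat.card G) : ∃ x : G, orderOf x = d := by
  obtain ⟨g, hg⟩ := IsCyclic.exists_ofOrder_eq_natCard (α := G)
  rw [← hg] at hd
  exact ⟨g ^ (orderOf g / d), orderOf_pow_orderOf_div (orderOf_pos g).ne' hd⟩

theorem exists_primeFactors_orderOf_eq {A : Finset ℕ} (hA : A ⊆ (Nat.card G).primeFactors) :
    ∃ x : G, (orderOf x).primeFactors = A := by
  obtain ⟨x, hx⟩ := exists_orderOf_eq_of_dvd_card (G := G) (d := ∏ q ∈ A, q)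
    ((Finset.prod_dvd_prod_of_subset _ _ _ hA).trans (Nat.prod_primeFactors_dvd _))
  exact ⟨x, hx ▸ Nat.primeFactors_prod fun q hq => Nat.prime_of_mem_primeFactors (hA hq)⟩

theorem genNonCoprimeGraph_eq_meetGraph (hsq : Squarefree (Nat.card G)) (H : Subgroup G) :
    genNonCoprimeGraph H = meetGraph (fun x : {x : G // x ≠ 1} => (orderOf (x : G)).primeFactors)
      (Nat.card H).primeFactors := by
  have mem_iff (x : G) : x ∈ H ↔ (orderOf x).primeFactors ⊆ (Nat.card H).primeFactors := by
    rw [mem_subgroup_iff_orderOf_dvd_card,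
      dvd_iff_primeFactors_subset (hsq.squarefree_of_dvd (orderOf_dvd_natCard x)) Nat.card_pos.ne']
  ext a b
  rw [meetGraph_adj, Nat.disjoint_primeFactors (orderOf_pos _).ne' (orderOf_pos _).ne', ← mem_iff,
    ← mem_iff]
  rfl

theorem theoremt_general (hsq : Squarefree (Nat.card G))
    (hcard : (Nat.card G).primeFactors.card ≤ 4) (H : Subgroup G) :
    IsPerfectGraph (genNonCoprimeGraph H) ∧
    ((¬ ∃ q₁ q₂ q₃ : ℕ, q₁.Prime ∧ q₂.Prime ∧ q₃.Prime ∧ Nat.card H = q₁ * q₂ * q₃) →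
      ∀ n : ℕ, 4 < n →
        ¬ (SimpleGraph.cycleGraph n).IsIndContained (genNonCoprimeGraph H) ∧
        ¬ (SimpleGraph.cycleGraph n)ᶜ.IsIndContained (genNonCoprimeGraph H)) ∧
    ((∃ q₁ q₂ q₃ : ℕ, q₁.Prime ∧ q₂.Prime ∧ q₃.Prime ∧ Nat.card H = q₁ * q₂ * q₃) → H ≠ ⊤ →
      (SimpleGraph.cycleGraph 6).IsIndContained (genNonCoprimeGraph H)) := by
  rw [genNonCoprimeGraph_eq_meetGraph hsq,
    ← card_primeFactors_eq_three_iff (hsq.squarefree_of_dvd H.card_subgroup_dvd_card)]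
  have label_nonempty (x : {x : G // x ≠ 1}) : (orderOf (x : G)).primeFactors.Nonempty := by
    have := orderOf_pos (x : G)
    have := mt orderOf_eq_one_iff.1 x.2
    exact Nat.nonempty_primeFactors.2 (by lia)
  have label_subset (x : {x : G // x ≠ 1}) := primeFactors_orderOf_subset (x : G)
  have hHG := Nat.primeFactors_mono H.card_subgroup_dvd_card Nat.card_pos.ne'
  refine ⟨isPerfectGraph_meetGraph label_nonempty label_subset hHG hcard, fun hH n hn => ?_,
    fun hH hHtop => ?_⟩
  · have : NeZero n := ⟨by lia⟩
    have no_hole (Δ : SimpleGraph (Fin n)) (hΔ : IsHoleLike Δ) :=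
      not_isIndContained_meetGraph hΔ label_nonempty label_subset hHG hcard hH
    exact (isHoleLike_cycleGraph hn).imp (no_hole _) (no_hole _)
  · refine cycleGraph_six_isIndContained_meetGraph (fun A hA hA0 => ?_) hH
      (hHG.ssubset_of_not_subset fun hGH => hHtop (H.eq_top_of_le_card ?_))
    · obtain ⟨x, rfl⟩ := exists_primeFactors_orderOf_eq hA
      exact ⟨⟨x, by rintro rfl; simp at hA0⟩, rfl⟩
    · exact Nat.le_of_dvd Nat.card_pos
        ((dvd_iff_primeFactors_subset hsq Nat.card_pos.ne').2 hGH)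

end CyclicGroup

theorem theoremt {G : Type*} [Group G] [Finite G] [IsCyclic G]
    (p : Fin 4 → ℕ) (hp : ∀ i, (p i).Prime) (hinj : Function.Injective p)
    (hG : Nat.card G = p 0 * p 1 * p 2 * p 3)
    (H : Subgroup G) (hH : H ≠ ⊥) :
    IsPerfectGraph (genNonCoprimeGraph H) ∧
    ((¬ ∃ q₁ q₂ q₃ : ℕ, q₁.Prime ∧ q₂.Prime ∧ q₃.Prime ∧ Nat.card H = q₁ * q₂ * q₃) →
      ∀ n : ℕ, 4 < n →
        ¬ (SimpleGraph.cycleGraph n).IsIndContained (genNonCoprimeGraph H) ∧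
        ¬ (SimpleGraph.cycleGraph n)ᶜ.IsIndContained (genNonCoprimeGraph H)) ∧
    ((∃ q₁ q₂ q₃ : ℕ, q₁.Prime ∧ q₂.Prime ∧ q₃.Prime ∧ Nat.card H = q₁ * q₂ * q₃) →
      (SimpleGraph.cycleGraph 6).IsIndContained (genNonCoprimeGraph H)) := by
  rw [← Fin.prod_univ_four] at hG
  have hsq : Squarefree (Nat.card G) := hG ▸ squarefree_prod_primes hp hinj
  have hcard : (Nat.card G).primeFactors.card = 4 := hG ▸ card_primeFactors_prod_primes hp hinj
  obtain ⟨hperfect, hholes, hhexagon⟩ := theoremt_general hsq hcard.le H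
  refine ⟨hperfect, hholes, fun h3 => hhexagon h3 ?_⟩
  rintro rfl
  rw [Subgroup.card_top, ← card_primeFactors_eq_three_iff hsq] at h3
  lia
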